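/- **Diagrams and the polynomial.** Let $D$ be an oriented virtual link diagram with $m\ge 1$ classical crossings $c_1,\dots,c_m$. An arc of $D$ runs from one classical crossing to the next one, ignoring virtual crossings; let the $2m$ arcs be labelled $x_1,\dots,x_{2m}$. At a classical crossing let $o,o'$ be the incoming and outgoing arcs of the over-strand and $w,w'$ the incoming and outgoing arcs of the under-strand. The crossing gives two linear relations, in this order: $w+u\,o-o'-u\,w'=0$ and $v\,o'-o=0$ if it is positive; $o+u\,w-w'-u\,o'=0$ and $v\,o-o'=0$ if it is negative. The Alexander matrix has these $2m$ relations as rows (two consecutive rows for each crossing) and the columns $x_1,\dots,x_{2m}$; $\Delta_0(D)\in\mathbb Z[u,v]$ is its determinant (not normalized). **Virtual twist knots.** Let $n\ge 1$ and let $a_1,\dots,a_n\ge 0$ be integers. The standard diagram $VT(a_1,\dots,a_n)$ consists of a twist and a clasp. The twist is a horizontal row of crossings: $n$ blocks of $a_1,\dots,a_n$ classical crossings from left to right, consecutive blocks being separated by one virtual crossing. Of its two strands, the odd one runs from left to right and starts at the top left, the even one runs from right to left; they exchange top and bottom at every (classical or virtual) crossing. At each classical crossing of the twist the line of positive slope passes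 over (a positive crossing), so the odd strand is the under-strand if it arrives at the top and the over-strand if it arrives at the bottom. The clasp consists of one virtual and one classical crossing: a loop from the left end of the even strand to the left end of the odd strand passes over a loop from the right end of the odd strand to the right end of the even strand; this classical crossing is positive if $\sum_i a_i+n-1$ (the number of crossings in the twist) is odd and negative otherwise. The arcs of the odd strand are labelled $x_1,x_3,x_5,\dots$ and those of the even strand $x_2,x_4,x_6,\dots$, both from left to right. **Functions.** Let $p(k)\in\{0,1\}$ be the parity of $k$, and for $0\le i\le n$ (for $\varepsilon$: $1\le i\le n$) $$s(i)=\sum_{j=1}^{i}(a_j+1),\qquad \delta=\sum_{j=1}^n p(a_j)\,p(s(j)),$$ $$\varepsilon(i)=\bigl(p(s(i-1))-1\bigr)+\sum_{j<i}p(a_j)\,p(s(j))+\sum_{j\ge i}p(a_j)\,p(1+s(j-1)).$$ **Theorem.** For all $n\ge 1$ and all integers $a_1,\dots,a_n\ge 0$, the polynomial $(u-1)(v-1)(uv-1)$ divides $\Delta_0(VT(a_1,\dots,a_n))$ in $\mathbb Z[u,v]$, and the quotients, defined by $\Delta_0=(u-1)(v-1)(uv-1)\,\overline{\Delta}_0$,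 satisfy, in $\mathbb Q(u,v)$, $$\overline{\Delta}_0(VT(a_1,\dots,a_n))=(-uv)^{\sum_{i=1}^n\lfloor a_i/2\rfloor}\Bigl(\overline{\Delta}_0(VT(p(a_1),\dots,p(a_n)))+(-1)^{\delta+s(n)}\sum_{i=1}^n\Bigl\lfloor\frac{a_i}{2}\Bigr\rfloor(uv)^{\varepsilon(i)}\Bigr).$$ -/

import Mathlib

noncomputable section

namespace VirtualTwist

/-! ### Oriented virtual link diagrams with labelled arcs, and their Alexander polynomial -/

/-- The polynomial ring `ℤ[u, v]`. -/
abbrev PolyUV : Type := MvPolynomial (Fin 2) ℤ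

/-- The variable `u`. -/
def u : PolyUV := MvPolynomial.X 0

/-- The variable `v`. -/
def v : PolyUV := MvPolynomial.X 1

/-- The field of rational functions `ℚ(u, v)`. It contains the Laurent polynomials in `u, v`. -/
abbrev RatUV : Type := FractionRing PolyUV

/-- The labels of the `2 m` arcs `x₁, x₂, …, x₂ₘ` of a diagram with `m` classical crossings:
`(i, 0)` stands for `x_{2i+1}` and `(i, 1)` stands for `x_{2i+2}` (`i = 0, …, m - 1`). -/
abbrev Arc (m : ℕ) : Type := Fin m × Fin 2

/-- An oriented virtual link diagram with `m` classical crossings and labelled arcs, given by its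
Gauss data. An arc runs from one classical crossing to the next one, ignoring the virtual crossings
in between; each classical crossing has a sign and is passed by an over-strand and by an
under-strand, each with an incoming and an outgoing arc. -/
structure VirtualDiagram (m : ℕ) where
  /-- Whether the crossing is positive (otherwise it is negative). -/
  positive : Fin m → Bool
  /-- The arc that enters the crossing as the over-strand. -/
  overIn : Fin m → Arc m
  /-- The arc that leaves the crossing as the over-strand. -/
  overOut : Fin m → Arc m
  /-- The arc that enters the crossing as the under-strand. -/
  underIn : Fin m → Arc m
  /-- The arc that leaves the crossing as the under-strand. -/
  underOut : Fin m → Arc m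
  /-- Each arc ends at exactly one passage (`true`: over, `false`: under) of one crossing. -/
  existsUnique_end : ∀ x : Arc m, ∃! c : Fin m × Bool,
    (bif c.2 then overIn c.1 else underIn c.1) = x
  /-- Each arc starts at exactly one passage of one crossing. -/
  existsUnique_start : ∀ x : Arc m, ∃! c : Fin m × Bool,
    (bif c.2 then overOut c.1 else underOut c.1) = x

/-- The two Alexander relations at the crossing `c`, as vectors of coefficients of the arcs (if an
arc occurs twice in a relation, its coefficients add up). At a positive crossing they are
`underIn + u overIn - overOut - u underOut = 0` and `v overOut - overIn = 0`;
at a negative crossing they are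
`overIn + u underIn - underOut - u overOut = 0` and `v overIn - overOut = 0`. -/
def alexanderRelation {m : ℕ} (D : VirtualDiagram m) (c : Fin m) : Fin 2 → Arc m → PolyUV :=
  if D.positive c then
    ![Pi.single (D.underIn c) 1 + Pi.single (D.overIn c) u
        - Pi.single (D.overOut c) 1 - Pi.single (D.underOut c) u,
      Pi.single (D.overOut c) v - Pi.single (D.overIn c) 1]
  else
    ![Pi.single (D.overIn c) 1 + Pi.single (D.underIn c) u
        - Pi.single (D.underOut c) 1 - Pi.single (D.overOut c) u,
      Pi.single (D.overIn c) v - Pi.single (D.overOut c) 1]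

/-- The Alexander matrix: the rows are the relations (two for each crossing, the crossings in
order), the columns are the arcs `x₁, …, x₂ₘ`. Rows and columns have the same index type, both in
lexicographic order, so that the determinant has a well-defined sign. -/
def alexanderMatrix {m : ℕ} (D : VirtualDiagram m) : Matrix (Fin m × Fin 2) (Arc m) PolyUV :=
  Matrix.of fun r x => alexanderRelation D r.1 r.2 x

/-- The polynomial `Δ₀(D)(u, v)` of a labelled diagram: the determinant of its Alexander matrix. -/
def alexanderPoly {m : ℕ} (D : VirtualDiagram m) : PolyUV :=
  (alexanderMatrix D).det

/-- The polynomial `(u - 1) (v - 1) (u v - 1)`. -/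
def trivialFactor : PolyUV := (u - 1) * (v - 1) * (u * v - 1)

/-- The reduced polynomial of a labelled diagram: the quotient of `Δ₀(D)` by
`(u - 1) (v - 1) (u v - 1)`. -/
def reducedAlexander {m : ℕ} (D : VirtualDiagram m) : RatUV :=
  algebraMap PolyUV RatUV (alexanderPoly D) / algebraMap PolyUV RatUV trivialFactor

/-! ### The standard diagram of the virtual twist knot

The twist is a horizontal row of crossings. Its two strands are oriented oppositely: the *odd*
strand runs from left to right and starts at the top left, the *even* strand runs from right to
left. At every crossing of the row, classical or virtual, the strands exchange top and bottom.
At each classical crossing the line of positive slope is the over-strand; the strands being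
antiparallel, this is a positive crossing. -/

/-- A half-twist in the twist: a classical crossing or a virtual one. -/
inductive HalfTwist : Type
  | classical : HalfTwist
  | virtual : HalfTwist

/-- The crossings of the twist from left to right: blocks of `a₁, …, aₙ` classical crossings, any
two consecutive blocks separated by a single virtual crossing. -/
def twistWord : List ℕ → List HalfTwist
  | [] => []
  | [k] => List.replicate k HalfTwist.classical
  | k :: l :: ls => List.replicate k HalfTwist.classical ++ HalfTwist.virtual :: twistWord (l :: ls)

/-- For each classical crossing of the twist, from left to right: whether the odd strand arrives
there at the top (a crossing of type 1; otherwise it is of type 2). The argument `t` says whether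
the odd strand is at the top to the left of the first crossing. -/
def oddOnTop (t : Bool) : List HalfTwist → List Bool
  | [] => []
  | HalfTwist.classical :: w => t :: oddOnTop (!t) w
  | HalfTwist.virtual :: w => oddOnTop (!t) w

/-- Whether the odd strand, having entered at the top left, leaves the twist at the bottom right. -/
def oddLeavesBottom (w : List HalfTwist) : Bool := decide (Odd w.length)

/-- The knot diagram that consists of the twist `w` and a clasp with one virtual and one classical
crossing. The classical crossing of the clasp is the crossing `0`, the classical crossings of the
twist are the crossings `1, 2, …` from left to right.

The arcs of the odd strand of the twist are `(0, 0), (1, 0), …` and those of the even strand are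
`(0, 1), (1, 1), …`, both from left to right, so that the crossing `k + 1` lies between the arcs
`(k, 0), (k, 1)` on its left and `(k + 1, 0), (k + 1, 1)` on its right. If the odd strand arrives at
the top, it is the under-strand there, else the over-strand.

In the clasp, the left loop runs from the left end `(0, 1)` of the even strand to the left end
`(0, 0)` of the odd strand; it passes over the right loop, which runs from the right end of the odd
strand to the right end of the even strand. This crossing is positive precisely if the odd strand
leaves the twist at the bottom. -/
def twistDiagram (w : List HalfTwist) : VirtualDiagram ((oddOnTop true w).length + 1) where
  positive := Fin.cons (oddLeavesBottom w) fun _ => true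
  overIn := Fin.cons (0, 1) fun k =>
    bif (oddOnTop true w).get k then (k.succ, 1) else (k.castSucc, 0)
  overOut := Fin.cons (0, 0) fun k =>
    bif (oddOnTop true w).get k then (k.castSucc, 1) else (k.succ, 0)
  underIn := Fin.cons (Fin.last _, 0) fun k =>
    bif (oddOnTop true w).get k then (k.castSucc, 0) else (k.succ, 1)
  underOut := Fin.cons (Fin.last _, 1) fun k =>
    bif (oddOnTop true w).get k then (k.succ, 0) else (k.castSucc, 1)
  existsUnique_end := by
    refine Function.Bijective.existsUnique
      ((Fintype.bijective_iff_injective_and_card _).2 ⟨?_, by simp⟩)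
    rintro ⟨c, e⟩ ⟨c', e'⟩ h
    induction c using Fin.cases <;> induction c' using Fin.cases <;> cases e <;> cases e' <;>
      simp only [cond_true, cond_false, Fin.cons_zero, Fin.cons_succ] at h ⊢ <;>
      grind [Fin.castSucc_inj, Fin.succ_inj, Fin.succ_ne_zero, Fin.castSucc_ne_last]
  existsUnique_start := by
    refine Function.Bijective.existsUnique
      ((Fintype.bijective_iff_injective_and_card _).2 ⟨?_, by simp⟩)
    rintro ⟨c, e⟩ ⟨c', e'⟩ h
    induction c using Fin.cases <;> induction c' using Fin.cases <;> cases e <;> cases e' <;>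
      simp only [cond_true, cond_false, Fin.cons_zero, Fin.cons_succ] at h ⊢ <;>
      grind [Fin.castSucc_inj, Fin.succ_inj, Fin.succ_ne_zero, Fin.castSucc_ne_last]

/-- The standard diagram of the virtual twist knot `VT(a₁, …, aₙ)` with all `aᵢ ≥ 0`. -/
def VT {n : ℕ} (a : Fin n → ℕ) :
    VirtualDiagram ((oddOnTop true (twistWord (List.ofFn a))).length + 1) :=
  twistDiagram (twistWord (List.ofFn a))

/-! ### The combinatorial functions in the recursion

Blocks are indexed from `0` here, so that `a i` is `a_{i+1}`. -/

/-- The parity of a natural number, `0` or `1`. -/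
def p (k : ℕ) : ℕ := k % 2

/-- `s(i) = ∑_{j=1}^{i} (a_j + 1)`, the sum over the first `i` blocks. -/
def s {n : ℕ} (a : Fin n → ℕ) (i : ℕ) : ℕ :=
  ∑ j : Fin n with j.val < i, (a j + 1)

/-- `δ = ∑_{j=1}^{n} p(a_j) p(s(j))`. -/
def δ {n : ℕ} (a : Fin n → ℕ) : ℕ :=
  ∑ j : Fin n, p (a j) * p (s a (j + 1))

/-- `ε(i) = (p(s(i-1)) - 1) + ∑_{j<i} p(a_j) p(s(j)) + ∑_{j≥i} p(a_j) p(1 + s(j-1))`, an integer. -/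
def ε {n : ℕ} (a : Fin n → ℕ) (i : Fin n) : ℤ :=
  ((p (s a i) : ℤ) - 1)
    + ∑ j : Fin n with j < i, (p (a j) : ℤ) * p (s a (j + 1))
    + ∑ j : Fin n with i ≤ j, (p (a j) : ℤ) * p (1 + s a j)

end VirtualTwist

end

/-! Group the arcs into (odd, even) pairs. The Alexander matrix is then a cyclic matrix of 2×2
blocks: a twist crossing relates neighbouring pairs, the clasp relates the first pair to the last.
Once `u` and `v` are units, each twist crossing can be solved for its right pair, and `Δ₀` becomes a
monomial `weight` times a 2×2 determinant `claspDet` in the entries `x, y, τ` of the composed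
transfer matrix (`det_cyclicBlocks`, `map_alexanderPoly`).

Divisibility: `claspDet` vanishes for `v = 1`, which forces `x = 1`; for `u = 1`, which forces `y =
1`; and for `uv = 1`, which forces `x = y` and `τ = 0`.

Recursion: two consecutive crossings of a block have opposite types. Such a pair leaves `x` and `y`
unchanged, multiplies the weight by `-uv`, and otherwise only changes `τ`, in which `claspDet` is
affine with slope `±(u-1)(v-1)`. The change of `τ` carries the missing factor `uv-1`, the even scale
of what follows and the difference scale of what precedes. Times the weight, these scales are powers
of `uv` with the common sign `(-1)^δ`; the exponents add up to `ε` (`shear_blockTypes_append`,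
`weight_mul_shear_p`). -/

noncomputable section
namespace VirtualTwist

/-! ### Determinants of cyclic block matrices -/

section Blocks

variable {R : Type*} [CommRing R] {m : ℕ} {ι : Type*} [Fintype ι] [DecidableEq ι]

/-- The determinant of a matrix of square blocks that is block triangular after a permutation of
the blocks is the product of the determinants of the diagonal blocks. -/
theorem det_comp_of_triangular (N : Matrix (Fin m) (Fin m) (Matrix ι ι R))
    (σ : Equiv.Perm (Fin m)) (h : ∀ i j, σ j < σ i → N i j = 0) :
    (Matrix.comp _ _ _ _ R N).det = ∏ i, (N i i).det := by
  have hb : (Matrix.comp _ _ _ _ R N).BlockTriangular fun x => σ x.1 := by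
    rintro ⟨i, a⟩ ⟨j, b⟩ hij
    simp [Matrix.comp_apply, h i j hij]
  rw [hb.det_fintype, ← Equiv.prod_comp σ]
  refine Finset.prod_congr rfl fun i _ => ?_
  let e : ι ≃ {x : Fin m × ι // σ x.1 = σ i} :=
    { toFun := fun a => ⟨(i, a), rfl⟩
      invFun := fun x => x.1.2
      left_inv := fun a => rfl
      right_inv := by
        rintro ⟨⟨j, a⟩, hj⟩
        obtain rfl := σ.injective hj
        rfl }
  rw [← Matrix.det_submatrix_equiv_self e]
  rfl

/-- The matrix of blocks with the first row `A, 0, …, 0, B` and the further rows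
`0, …, 0, Cₖ, Dₖ, 0, …, 0`. -/
def cyclicBlocks (A B : Matrix ι ι R) (C D : Fin m → Matrix ι ι R) :
    Matrix (Fin (m + 1)) (Fin (m + 1)) (Matrix ι ι R) :=
  Matrix.of (Fin.cons (Pi.single 0 A + Pi.single (Fin.last m) B) fun k =>
    Pi.single k.castSucc (C k) + Pi.single k.succ (D k))

/-- Block Gaussian elimination: `X` solves all rows but the first, so adding multiples of the other
block columns to column `0` leaves only its top block. -/
theorem det_cyclicBlocks (A B : Matrix ι ι R) (C D : Fin m → Matrix ι ι R)
    (X : Fin (m + 1) → Matrix ι ι R) (h0 : X 0 = 1)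
    (hX : ∀ k, C k * X k.castSucc + D k * X k.succ = 0) :
    (Matrix.comp _ _ _ _ R (cyclicBlocks A B C D)).det =
      (∏ k, (D k).det) * (A + B * X (Fin.last m)).det := by
  let T : Matrix (Fin (m + 1)) (Fin (m + 1)) (Matrix ι ι R) :=
    Matrix.of fun i => Function.update (Pi.single i 1) 0 (X i)
  have hT : (Matrix.comp _ _ _ _ R T).det = 1 := by
    rw [det_comp_of_triangular T Fin.revPerm]
    · refine Finset.prod_eq_one fun i _ => ?_
      rcases eq_or_ne i 0 with rfl | hi
      · simp [T, h0]
      · simp [T, hi]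
    · intro i j hij
      rw [Fin.revPerm_apply, Fin.revPerm_apply, Fin.rev_lt_rev] at hij
      simp [T, (Fin.pos_of_ne_zero (Fin.ne_zero_of_lt hij)).ne', hij.ne']
  have hrow (r : Fin (m + 1) → Matrix ι ι R) (j : Fin (m + 1)) (hj : j ≠ 0) :
      ∑ c, r c * T c j = r j := by
    simp [T, hj, Pi.single_apply]
  have hcol (r : Fin (m + 1) → Matrix ι ι R) : ∑ c, r c * T c 0 = ∑ c, r c * X c := by
    simp [T]
  have key : Matrix.comp _ _ _ _ R (cyclicBlocks A B C D * T) =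
      Matrix.comp _ _ _ _ R (cyclicBlocks A B C D) * Matrix.comp _ _ _ _ R T :=
    map_mul (Matrix.compRingEquiv (Fin (m + 1)) ι R) _ _
  -- Negation in `Fin (m + 1)` orders the blocks as `0, m, m-1, …, 1`; in this order the product
  -- with `T` is upper triangular.
  rw [← mul_one (Matrix.det _), ← hT, ← Matrix.det_mul, ← key,
    det_comp_of_triangular _ (Equiv.neg _)]
  · rw [Fin.prod_univ_succ, mul_comm]
    congr 1
    · refine Finset.prod_congr rfl fun k _ => ?_
      rw [Matrix.mul_apply, hrow _ _ (Fin.succ_ne_zero k)]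
      simp [cyclicBlocks, k.castSucc_lt_succ.ne']
    · rw [Matrix.mul_apply, hcol]
      simp [cyclicBlocks, add_mul, Finset.sum_add_distrib, Pi.single_apply, ite_mul, h0]
  · intro i j hij
    rw [Matrix.mul_apply]
    induction i using Fin.cases with
    | zero => simp at hij
    | succ k =>
      rcases eq_or_ne j 0 with rfl | hj
      · rw [hcol]
        simp [cyclicBlocks, add_mul, Finset.sum_add_distrib, Pi.single_apply, ite_mul, hX]
      · have hlt : k.succ < j := by
          simp only [Equiv.neg_apply, Fin.lt_def, Fin.val_neg, hj, Fin.succ_ne_zero,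
            if_false] at hij ⊢
          omega
        rw [hrow _ _ hj]
        simp [cyclicBlocks, hlt.ne', (k.castSucc_lt_succ.trans hlt).ne']

end Blocks

/-! ### Transfer matrices of the twist and the clasp determinant -/

section Transfer

variable {R : Type*} [CommRing R]

/-- The linear map, in the coordinates (odd arc, even arc), that multiplies the even arc by `x` and
adds `τ` times the difference (odd arc) - (even arc) to it, and multiplies this difference by `y`. -/
def transfer (x y τ : R) : Matrix (Fin 2) (Fin 2) R :=
  !![τ + y, x - τ - y; τ, x - τ]

theorem transfer_mul (x y τ x' y' τ' : R) :
    transfer x y τ * transfer x' y' τ' = transfer (x * x') (y * y') (x * τ' + τ * y') := by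
  ext i j
  fin_cases i <;> fin_cases j <;> simp [transfer, Matrix.mul_apply, Fin.sum_univ_two] <;> ring

theorem transfer_one : transfer (1 : R) 1 0 = 1 := by
  ext i j
  fin_cases i <;> fin_cases j <;> simp [transfer]

variable (U V : Rˣ)

/-- The factor of the even arc along crossings of the twist, given by their types. -/
def evenScale (l : List Bool) : Rˣ := (l.map fun t => bif t then V else V⁻¹).prod

/-- The factor of the difference of the arcs along crossings of the twist. -/
def diffScale (l : List Bool) : Rˣ := (l.map fun t => bif t then U⁻¹ else U).prod

/-- The coefficient of the difference in the even arc along crossings of the twist. -/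
def shear : List Bool → R
  | [] => 0
  | t :: l => evenScale V l * (bif t then 0 else (↑V⁻¹ - ↑U)) +
      shear l * ((bif t then U⁻¹ else U : Rˣ) : R)

/-- The product of the determinants of the outgoing blocks of crossings of the twist. -/
def weight (l : List Bool) : Rˣ := (l.map fun t => bif t then U else -V).prod

/-- The transfer matrix of a sequence of crossings of the twist. -/
def listTransfer (l : List Bool) : Matrix (Fin 2) (Fin 2) R :=
  transfer (evenScale V l) (diffScale U l) (shear U V l)

theorem evenScale_append (l l' : List Bool) :
    evenScale V (l ++ l') = evenScale V l * evenScale V l' := by simp [evenScale]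

theorem diffScale_append (l l' : List Bool) :
    diffScale U (l ++ l') = diffScale U l * diffScale U l' := by simp [diffScale]

theorem weight_append (l l' : List Bool) :
    weight U V (l ++ l') = weight U V l * weight U V l' := by simp [weight]

theorem shear_append (l l' : List Bool) :
    shear U V (l ++ l') = evenScale V l' * shear U V l + shear U V l' * diffScale U l := by
  induction l with
  | nil => simp [shear, diffScale]
  | cons t l ih =>
    simp only [List.cons_append, shear, ih, evenScale_append, diffScale, List.map_cons,
      List.prod_cons, Units.val_mul]
    ring

theorem listTransfer_append (l l' : List Bool) :
    listTransfer U V (l ++ l') = listTransfer U V l' * listTransfer U V l := by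
  rw [listTransfer, listTransfer, listTransfer, transfer_mul, evenScale_append, diffScale_append,
    shear_append, Units.val_mul, Units.val_mul, mul_comm (evenScale V l : R),
    mul_comm (diffScale U l : R)]

/-- The block of the left arcs of a crossing of the twist. -/
def leftBlock (t : Bool) : Matrix (Fin 2) (Fin 2) R :=
  bif t then !![1, -1; 0, ↑V] else !![↑U, -↑U; -1, 0]

/-- The block of the right arcs of a crossing of the twist. -/
def rightBlock (t : Bool) : Matrix (Fin 2) (Fin 2) R :=
  bif t then !![-↑U, ↑U; 0, -1] else !![-1, 1; ↑V, 0]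

theorem leftBlock_add_rightBlock_mul (t : Bool) :
    leftBlock U V t + rightBlock U V t * listTransfer U V [t] = 0 := by
  ext i j
  cases t <;> fin_cases i <;> fin_cases j <;>
    simp [leftBlock, rightBlock, listTransfer, transfer, shear, evenScale, diffScale,
      mul_sub]
  ring

/-- The block of the left ends of the twist in the relations of the clasp. -/
def claspLeft (pos : Bool) : Matrix (Fin 2) (Fin 2) R :=
  bif pos then !![-1, ↑U; ↑V, -1] else !![-↑U, 1; -1, ↑V]

/-- The block of the right ends of the twist in the relations of the clasp. -/
def claspRight (pos : Bool) : Matrix (Fin 2) (Fin 2) R :=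
  bif pos then !![1, -↑U; 0, 0] else !![↑U, -1; 0, 0]

/-- The determinant of the relations that remain of the clasp after elimination of the twist. -/
def claspDet (pos : Bool) (u v x y τ : R) : R :=
  bif pos then (v - 1) * ((1 - u) * τ + y - 1) - v * (1 - u) * (x - 1)
  else (v - 1) * ((u - 1) * τ + u * (y - 1)) - (1 - u) * (x - 1)

theorem det_clasp (pos : Bool) (x y τ : R) :
    (claspLeft U V pos + claspRight U pos * transfer x y τ).det = claspDet pos ↑U ↑V x y τ := by
  cases pos <;>
    simp [claspLeft, claspRight, claspDet, transfer, Matrix.det_fin_two] <;> ring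

theorem det_rightBlock (t : Bool) :
    (rightBlock U V t).det = ((bif t then U else -V : Rˣ) : R) := by
  cases t <;> simp [rightBlock, Matrix.det_fin_two]

variable {U V}

theorem map_alexanderMatrix (φ : PolyUV →+* R) (hu : φ u = U) (hv : φ v = V)
    (w : List HalfTwist) :
    φ.mapMatrix (alexanderMatrix (twistDiagram w)) =
      Matrix.comp _ _ _ _ R (cyclicBlocks (claspLeft U V (oddLeavesBottom w))
        (claspRight U (oddLeavesBottom w))
        (fun k => leftBlock U V ((oddOnTop true w).get k))
        fun k => rightBlock U V ((oddOnTop true w).get k)) := by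
  have hs (x y : Arc ((oddOnTop true w).length + 1)) (c : PolyUV) :
      φ ((Pi.single x c : _ → PolyUV) y) = if y.1 = x.1 then if y.2 = x.2 then φ c else 0 else 0 := by
    simp only [Pi.single_apply, Prod.ext_iff, ite_and, apply_ite φ, map_zero]
  have hm (x y : Fin ((oddOnTop true w).length + 1)) (A : Matrix (Fin 2) (Fin 2) R) (i j : Fin 2) :
      (Pi.single x A : _ → Matrix (Fin 2) (Fin 2) R) y i j = if y = x then A i j else 0 := by
    rw [Pi.single_apply]; split_ifs <;> rfl
  ext ⟨r, i⟩ ⟨c, j⟩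
  induction r using Fin.cases with
  | zero =>
    cases hp : oddLeavesBottom w <;> fin_cases i <;> fin_cases j <;>
      simp [alexanderMatrix, alexanderRelation, twistDiagram, hp, Matrix.comp_apply, cyclicBlocks,
        claspLeft, claspRight, hs, hm, hu, hv] <;> split_ifs <;> ring
  | succ k =>
    cases hp : (oddOnTop true w).get k <;> rw [List.get_eq_getElem] at hp <;>
      fin_cases i <;> fin_cases j <;>
      simp [alexanderMatrix, alexanderRelation, twistDiagram, hp, Matrix.comp_apply, cyclicBlocks,
        leftBlock, rightBlock, hs, hm, hu, hv] <;> split_ifs <;> ring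

/-- An arbitrary `φ` with unit values lets one formula serve `ℚ(u, v)`, the specializations `u = 1`
and `v = 1`, and the quotient by `uv - 1`. -/
theorem map_alexanderPoly (φ : PolyUV →+* R) (hu : φ u = U) (hv : φ v = V) (w : List HalfTwist) :
    φ (alexanderPoly (twistDiagram w)) =
      weight U V (oddOnTop true w) * claspDet (R := R) (oddLeavesBottom w) ↑U ↑V
        (evenScale V (oddOnTop true w)) (diffScale U (oddOnTop true w))
        (shear U V (oddOnTop true w)) := by
  rw [alexanderPoly, RingHom.map_det, map_alexanderMatrix φ hu hv,
    det_cyclicBlocks _ _ _ _ fun k => listTransfer U V ((oddOnTop true w).take k)]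
  · rw [← det_clasp, Fin.val_last, List.take_length, listTransfer]
    congr 1
    simp only [det_rightBlock, weight, ← Units.coe_prod]
    rw [← List.prod_ofFn]
    change ((List.ofFn ((fun t => bif t then U else -V) ∘ (oddOnTop true w).get)).prod : R) = _
    rw [← List.map_ofFn, List.ofFn_get]
  · simp [listTransfer, evenScale, diffScale, shear, transfer_one]
  · intro k
    rw [Fin.val_succ, List.take_succ_eq_append_getElem k.isLt, listTransfer_append, ← mul_assoc,
      Fin.val_castSucc, ← add_mul, List.get_eq_getElem, leftBlock_add_rightBlock_mul, zero_mul]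

end Transfer

/-! ### Divisibility by the three factors -/

section Divisibility

/-- An endomorphism that is the identity modulo `q` on the variables is so on all polynomials, hence
`P ≡ f P = 0`. -/
theorem dvd_of_ringHom_eq_zero (q : PolyUV) (f : PolyUV →+* PolyUV) (hu : q ∣ u - f u)
    (hv : q ∣ v - f v) (P : PolyUV) (hP : f P = 0) : q ∣ P := by
  rw [← Ideal.mem_span_singleton, ← Ideal.Quotient.eq_zero_iff_mem]
  have : Ideal.Quotient.mk (Ideal.span {q}) =
      (Ideal.Quotient.mk (Ideal.span {q})).comp f := by
    refine MvPolynomial.ringHom_ext (fun n => by simp) fun i => ?_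
    rw [RingHom.comp_apply, Ideal.Quotient.eq, Ideal.mem_span_singleton]
    fin_cases i
    exacts [hu, hv]
  rw [this, RingHom.comp_apply, hP, map_zero]

theorem prime_uv_sub_one : Prime (u * v - 1) := by
  rw [← irreducible_iff_prime, sub_eq_add_neg]
  refine MvPolynomial.irreducible_mul_X_add _ _ _ (MvPolynomial.X_ne_zero 0) ?_ ?_
    isUnit_one.neg.isRelPrime_right
  · simp [u]
  · simp

theorem evenScale_one {R : Type*} [CommRing R] (l : List Bool) : evenScale (1 : Rˣ) l = 1 := by
  simp [evenScale]

theorem diffScale_one {R : Type*} [CommRing R] (l : List Bool) : diffScale (1 : Rˣ) l = 1 := by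
  simp [diffScale]

theorem shear_inv {R : Type*} [CommRing R] (U : Rˣ) (l : List Bool) : shear U U⁻¹ l = 0 := by
  induction l with
  | nil => rfl
  | cons t l ih => cases t <;> simp [shear, ih]

theorem algebraMap_u_ne_zero : algebraMap PolyUV RatUV u ≠ 0 := by
  simp [u, MvPolynomial.X_ne_zero]

theorem algebraMap_v_ne_zero : algebraMap PolyUV RatUV v ≠ 0 := by
  simp [v, MvPolynomial.X_ne_zero]

theorem v_sub_one_dvd (w : List HalfTwist) : v - 1 ∣ alexanderPoly (twistDiagram w) := by
  have hu := algebraMap_u_ne_zero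
  -- After setting `v = 1`, pass to the fraction field, where `u` is a unit.
  refine dvd_of_ringHom_eq_zero _ (MvPolynomial.aeval ![u, 1] : PolyUV →ₐ[ℤ] PolyUV).toRingHom
    (by simp [u]) (by simp [v]) _ ((IsFractionRing.injective PolyUV RatUV).eq_iff.1 ?_)
  rw [map_zero, ← RingHom.comp_apply, map_alexanderPoly
    (U := Units.mk0 _ hu) (V := 1) _ (by simp [u]) (by simp [v])]
  rw [evenScale_one, claspDet]
  cases oddLeavesBottom w <;> simp

theorem u_sub_one_dvd (w : List HalfTwist) (P : PolyUV)
    (h : (v - 1) * P = alexanderPoly (twistDiagram w)) : u - 1 ∣ P := by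
  let f := (MvPolynomial.aeval ![1, v] : PolyUV →ₐ[ℤ] PolyUV).toRingHom
  have hfu : f u = 1 := by simp [f, u]
  have hfv : f v = v := by simp [f, v]
  have hf : f (alexanderPoly (twistDiagram w)) = 0 := by
    have hv := algebraMap_v_ne_zero
    apply (IsFractionRing.injective PolyUV RatUV).eq_iff.1
    rw [map_zero, ← RingHom.comp_apply, map_alexanderPoly (U := 1)
      (V := Units.mk0 _ hv) _ (by simp [hfu]) (by simp [hfv])]
    rw [diffScale_one, claspDet]
    cases oddLeavesBottom w <;> simp
  refine dvd_of_ringHom_eq_zero _ f (by simp [hfu]) (by simp [hfv]) _ ?_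
  rw [← h, map_mul, map_sub, hfv, map_one] at hf
  refine (mul_eq_zero.1 hf).resolve_left fun h0 => ?_
  simpa [v] using congrArg (MvPolynomial.eval 0) h0

theorem uv_sub_one_dvd (w : List HalfTwist) : u * v - 1 ∣ alexanderPoly (twistDiagram w) := by
  rw [← Ideal.mem_span_singleton, ← Ideal.Quotient.eq_zero_iff_mem]
  set φ := Ideal.Quotient.mk (Ideal.span {u * v - 1})
  have h : φ u * φ v = 1 := by
    rw [← map_mul, ← map_one φ, Ideal.Quotient.eq]
    exact Ideal.mem_span_singleton_self _
  let U : (PolyUV ⧸ Ideal.span {u * v - 1})ˣ := Units.mkOfMulEqOne _ _ h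
  have hv : φ v = ((U⁻¹ :) : PolyUV ⧸ Ideal.span {u * v - 1}) := by
    rw [← Units.mul_right_inj U, Units.mul_inv]; exact h
  rw [map_alexanderPoly (U := U) (V := U⁻¹) φ rfl hv, shear_inv]
  have hx : evenScale U⁻¹ (oddOnTop true w) = diffScale U (oddOnTop true w) := by
    simp [evenScale, diffScale]
  rw [hx, claspDet]
  have := U.mul_inv
  cases oddLeavesBottom w <;> simp only [cond_true, cond_false] <;> linear_combination
    (weight U U⁻¹ (oddOnTop true w) : PolyUV ⧸ Ideal.span {u * v - 1}) *
      (diffScale U (oddOnTop true w) - 1) * this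

theorem trivialFactor_dvd (w : List HalfTwist) :
    trivialFactor ∣ alexanderPoly (twistDiagram w) := by
  obtain ⟨P, hP⟩ := v_sub_one_dvd w
  obtain ⟨Q, rfl⟩ := u_sub_one_dvd w P hP.symm
  have h := uv_sub_one_dvd w
  rw [hP, ← mul_assoc] at h
  -- At `u = v = -1` the prime `uv - 1` vanishes but `(v-1)(u-1) = 4` does not.
  obtain ⟨S, rfl⟩ := (prime_uv_sub_one.dvd_or_dvd h).resolve_left fun ⟨T, hT⟩ => by
    simpa [u, v] using congrArg (MvPolynomial.eval fun _ => -1) hT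
  exact ⟨S, by rw [hP, trivialFactor]; ring⟩

end Divisibility

/-! ### Crossing types from the parity of preceding half-twists -/

section Types

/-- The types of `k` consecutive crossings of the twist, after `b` half-twists. -/
def blockTypes : ℕ → ℕ → List Bool
  | _, 0 => []
  | b, k + 1 => decide (Even b) :: blockTypes (b + 1) k

/-- The types of the crossings of blocks separated by virtual crossings, after `b` half-twists. -/
def crossingTypes : ℕ → List ℕ → List Bool
  | _, [] => []
  | b, k :: l => blockTypes b k ++ crossingTypes (b + k + 1) l

theorem blockTypes_congr (k : ℕ) {b b' : ℕ} (h : b % 2 = b' % 2) :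
    blockTypes b k = blockTypes b' k := by
  induction k generalizing b b' with
  | zero => rfl
  | succ k ih =>
    rw [blockTypes, blockTypes, ih (b' := b' + 1) (by omega)]
    simp only [Nat.even_iff, h]

theorem crossingTypes_congr (l : List ℕ) {b b' : ℕ} (h : b % 2 = b' % 2) :
    crossingTypes b l = crossingTypes b' l := by
  induction l generalizing b b' with
  | nil => rfl
  | cons k l ih =>
    rw [crossingTypes, crossingTypes, blockTypes_congr k h, ih (b' := b' + k + 1) (by omega)]

theorem not_decide_even (b : ℕ) : (!decide (Even b)) = decide (Even (b + 1)) := by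
  simp only [Nat.even_add_one, decide_not]

theorem oddOnTop_replicate_append (k b : ℕ) (w : List HalfTwist) :
    oddOnTop (decide (Even b)) (List.replicate k HalfTwist.classical ++ w) =
      blockTypes b k ++ oddOnTop (decide (Even (b + k))) w := by
  induction k generalizing b with
  | zero => simp [blockTypes]
  | succ k ih =>
    rw [List.replicate_succ, List.cons_append, oddOnTop, not_decide_even, ih, blockTypes, List.cons_append,
      Nat.add_right_comm, Nat.add_assoc]

theorem oddOnTop_twistWord (l : List ℕ) (b : ℕ) :
    oddOnTop (decide (Even b)) (twistWord l) = crossingTypes b l := by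
  induction l generalizing b with
  | nil => rfl
  | cons k l ih =>
    cases l with
    | nil =>
      rw [twistWord, ← List.append_nil (List.replicate _ _), oddOnTop_replicate_append]
      rfl
    | cons k' l =>
      rw [twistWord, oddOnTop_replicate_append, oddOnTop, not_decide_even, ih]
      rfl

theorem length_twistWord (k : ℕ) (l : List ℕ) :
    (twistWord (k :: l)).length + 1 = ((k :: l).map (· + 1)).sum := by
  induction l generalizing k with
  | nil => simp [twistWord]
  | cons k' l ih =>
    have := ih k'
    simp only [twistWord, List.length_append, List.length_replicate, List.length_cons,
      List.map_cons, List.sum_cons] at this ⊢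
    omega

end Types

/-! ### Removing pairs of crossings from a block -/

section Blocks

variable {K : Type*} [Field K] (U V : Kˣ)

theorem evenScale_blockTypes (b k : ℕ) :
    evenScale V (blockTypes b k) = evenScale V (blockTypes b (k % 2)) := by
  induction k using Nat.twoStepInduction with
  | zero => rfl
  | one => rfl
  | more k ih _ =>
    rw [Nat.add_mod_right, ← ih, blockTypes, blockTypes,
      blockTypes_congr k (b := b + 1 + 1) (b' := b) (by omega)]
    by_cases hb : Even b <;> simp [evenScale, hb, Nat.even_add_one]

theorem diffScale_blockTypes (b k : ℕ) :
    diffScale U (blockTypes b k) = diffScale U (blockTypes b (k % 2)) := by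
  induction k using Nat.twoStepInduction with
  | zero => rfl
  | one => rfl
  | more k ih _ =>
    rw [Nat.add_mod_right, ← ih, blockTypes, blockTypes,
      blockTypes_congr k (b := b + 1 + 1) (b' := b) (by omega)]
    by_cases hb : Even b <;> simp [diffScale, hb, Nat.even_add_one]

theorem weight_blockTypes (b k : ℕ) :
    weight U V (blockTypes b k) = (-(U * V)) ^ (k / 2) * weight U V (blockTypes b (k % 2)) := by
  induction k using Nat.twoStepInduction with
  | zero => simp
  | one => simp
  | more k ih _ =>
    rw [Nat.add_mod_right, Nat.add_div_right _ two_pos, pow_succ', mul_assoc, ← ih, blockTypes,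
      blockTypes, blockTypes_congr k (b := b + 1 + 1) (b' := b) (by omega)]
    by_cases hb : Even b <;> simp [weight, hb, Nat.even_add_one, mul_assoc, mul_left_comm V U]

/-- The contribution of a pair of consecutive crossings, after `b` half-twists, to the shear. -/
def pairShear (b : ℕ) : K := -((U * V - 1) * (U * V : K) ^ ((p b : ℤ) - 1))

/-- A pair has scales `1`, so it only adds its own shear, carried on by the even scale of the rest.
The order of its two types decides between `(uv)⁻¹` and `1` in `pairShear`. -/
theorem shear_blockTypes_append (b k : ℕ) (l : List Bool) :
    shear U V (blockTypes b k ++ l) = shear U V (blockTypes b (k % 2) ++ l) +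
      (k / 2 : ℕ) * pairShear U V b * evenScale V (blockTypes b (k % 2) ++ l) := by
  induction k using Nat.twoStepInduction with
  | zero => simp
  | one => simp
  | more k ih _ =>
    rw [Nat.add_mod_right, Nat.add_div_right _ two_pos, Nat.cast_succ, blockTypes, blockTypes,
      blockTypes_congr k (b := b + 1 + 1) (b' := b) (by omega), add_mul, add_mul, ← add_assoc,
      ← ih, evenScale_append, ← evenScale_blockTypes, ← evenScale_append]
    simp only [List.cons_append, shear]
    generalize blockTypes b k ++ l = l'
    have hU := U.ne_zero
    have hV := V.ne_zero
    by_cases hb : Even b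
    · simp [evenScale, hb, Nat.even_add_one, pairShear, p, Nat.even_iff.1 hb]
      field_simp
      ring
    · simp [evenScale, hb, Nat.even_add_one, pairShear, p, Nat.not_even_iff.1 hb]
      field_simp
      ring

/-- Type 1 gives `U * V`, type 2 gives `-V * V⁻¹ = -1`. With `diffScale` instead the values are `1`
and `-V * U`: the same sign, which is why a single `δ` suffices. -/
theorem weight_mul_evenScale_blockTypes (b k : ℕ) :
    weight U V (blockTypes b (p k)) * evenScale V (blockTypes b (p k)) =
      (-1) ^ (p k * p (b + k + 1)) * (U * V) ^ (p k * p (1 + b)) := by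
  rcases Nat.mod_two_eq_zero_or_one k with hk | hk <;>
    rcases Nat.mod_two_eq_zero_or_one b with hb | hb <;>
    simp [p, hk, blockTypes, weight, evenScale, Nat.add_mod, hb, Nat.even_iff]

theorem weight_mul_diffScale_blockTypes (b k : ℕ) :
    weight U V (blockTypes b (p k)) * diffScale U (blockTypes b (p k)) =
      (-1) ^ (p k * p (b + k + 1)) * (U * V) ^ (p k * p (b + k + 1)) := by
  rcases Nat.mod_two_eq_zero_or_one k with hk | hk <;>
    rcases Nat.mod_two_eq_zero_or_one b with hb | hb <;>
    simp [p, hk, blockTypes, weight, diffScale, Nat.add_mod, hb, Nat.even_iff, mul_comm]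

end Blocks

/-! ### The exponents, with an offset for induction on the blocks -/

section Sums

theorem s_zero {n : ℕ} (a : Fin n → ℕ) : s a 0 = 0 := by simp [s]

theorem s_succ {n : ℕ} (a : Fin (n + 1) → ℕ) (i : ℕ) :
    s a (i + 1) = a 0 + 1 + s (fun j => a j.succ) i := by
  simp [s, Finset.sum_filter, Fin.sum_univ_succ]

/-- The function `δ` of blocks after `b` half-twists. -/
def shiftedδ (b : ℕ) {n : ℕ} (a : Fin n → ℕ) : ℕ :=
  ∑ j : Fin n, p (a j) * p (b + s a (j + 1))

/-- The number of odd blocks that begin with the odd strand at the top, after `b` half-twists. -/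
def topCount (b : ℕ) {n : ℕ} (a : Fin n → ℕ) : ℕ :=
  ∑ j : Fin n, p (a j) * p (1 + b + s a j)

/-- The function `ε` of blocks after `b` half-twists. -/
def shiftedε (b : ℕ) {n : ℕ} (a : Fin n → ℕ) (i : Fin n) : ℤ :=
  ((p (b + s a i) : ℤ) - 1)
    + ∑ j : Fin n with j < i, (p (a j) : ℤ) * p (b + s a (j + 1))
    + ∑ j : Fin n with i ≤ j, (p (a j) : ℤ) * p (1 + b + s a j)

variable (b : ℕ) {n : ℕ} (a : Fin (n + 1) → ℕ)

theorem shiftedδ_succ : shiftedδ b a =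
    p (a 0) * p (b + a 0 + 1) + shiftedδ (b + a 0 + 1) fun j => a j.succ := by
  simp [shiftedδ, Fin.sum_univ_succ, s_succ, s_zero, add_assoc]

theorem topCount_succ : topCount b a =
    p (a 0) * p (1 + b) + topCount (b + a 0 + 1) fun j => a j.succ := by
  simp [topCount, Fin.sum_univ_succ, s_succ, s_zero, add_assoc]

theorem shiftedε_zero : shiftedε b a 0 = (p b : ℤ) - 1 + topCount b a := by
  simp [shiftedε, topCount, s_zero]

theorem shiftedε_succ (i : Fin n) : shiftedε b a i.succ =
    (p (a 0) * p (b + a 0 + 1) : ℕ) + shiftedε (b + a 0 + 1) (fun j => a j.succ) i := by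
  simp [shiftedε, Finset.sum_filter, Fin.sum_univ_succ, s_succ, s_zero, add_assoc]
  ring

end Sums

/-! ### Reducing all blocks to their parities -/

section Recursion

variable {K : Type*} [Field K] (U V : Kˣ) {n : ℕ}

theorem crossingTypes_ofFn_succ (b : ℕ) (a : Fin (n + 1) → ℕ) :
    crossingTypes b (List.ofFn a) =
      blockTypes b (a 0) ++ crossingTypes (b + a 0 + 1) (List.ofFn fun j => a j.succ) := by
  rw [List.ofFn_succ, crossingTypes]

theorem crossingTypes_ofFn_p_succ (b : ℕ) (a : Fin (n + 1) → ℕ) :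
    crossingTypes b (List.ofFn fun j => p (a j)) =
      blockTypes b (p (a 0)) ++
        crossingTypes (b + a 0 + 1) (List.ofFn fun j => p (a j.succ)) := by
  rw [crossingTypes_ofFn_succ]
  congr 1
  exact crossingTypes_congr _ (by rw [p]; omega)

theorem evenScale_p (b : ℕ) (a : Fin n → ℕ) :
    evenScale V (crossingTypes b (List.ofFn a)) =
      evenScale V (crossingTypes b (List.ofFn fun j => p (a j))) := by
  induction n generalizing b with
  | zero => rfl
  | succ n ih =>
    rw [crossingTypes_ofFn_succ, crossingTypes_ofFn_p_succ, evenScale_append, evenScale_append,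
      evenScale_blockTypes, ih, p]

theorem diffScale_p (b : ℕ) (a : Fin n → ℕ) :
    diffScale U (crossingTypes b (List.ofFn a)) =
      diffScale U (crossingTypes b (List.ofFn fun j => p (a j))) := by
  induction n generalizing b with
  | zero => rfl
  | succ n ih =>
    rw [crossingTypes_ofFn_succ, crossingTypes_ofFn_p_succ, diffScale_append, diffScale_append,
      diffScale_blockTypes, ih, p]

theorem weight_p (b : ℕ) (a : Fin n → ℕ) :
    weight U V (crossingTypes b (List.ofFn a)) = (-(U * V)) ^ (∑ i, a i / 2) *
      weight U V (crossingTypes b (List.ofFn fun j => p (a j))) := by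
  induction n generalizing b with
  | zero => simp [crossingTypes]
  | succ n ih =>
    rw [crossingTypes_ofFn_succ, crossingTypes_ofFn_p_succ, weight_append, weight_append,
      weight_blockTypes, ih, p, Fin.sum_univ_succ, pow_add, mul_mul_mul_comm]

theorem weight_mul_evenScale_p (b : ℕ) (a : Fin n → ℕ) :
    weight U V (crossingTypes b (List.ofFn fun j => p (a j))) *
        evenScale V (crossingTypes b (List.ofFn fun j => p (a j))) =
      (-1) ^ shiftedδ b a * (U * V) ^ topCount b a := by
  induction n generalizing b with
  | zero => simp [crossingTypes, weight, evenScale, shiftedδ, topCount]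
  | succ n ih =>
    rw [crossingTypes_ofFn_p_succ, weight_append, evenScale_append, mul_mul_mul_comm,
      weight_mul_evenScale_blockTypes, ih, shiftedδ_succ, topCount_succ, pow_add, pow_add,
      mul_mul_mul_comm]

/-- The core of the recursion. Peeling off the first block, its removed pairs see the even scale of
everything after them, while changes in later blocks are multiplied by its difference scale. -/
theorem weight_mul_shear_p (b : ℕ) (a : Fin n → ℕ) :
    (weight U V (crossingTypes b (List.ofFn fun j => p (a j))) : K) *
        (shear U V (crossingTypes b (List.ofFn a)) -
          shear U V (crossingTypes b (List.ofFn fun j => p (a j)))) =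
      -((U * V - 1) * (-1) ^ shiftedδ b a *
        ∑ i, ((a i / 2 : ℕ) : K) * (U * V : K) ^ shiftedε b a i) := by
  induction n generalizing b with
  | zero => simp [crossingTypes]
  | succ n ih =>
    have hUV : (U * V : K) ≠ 0 := mul_ne_zero U.ne_zero V.ne_zero
    have hd := congrArg Units.val (weight_mul_diffScale_blockTypes U V b (a 0))
    have he := congrArg Units.val (weight_mul_evenScale_p U V b a)
    have hi := ih (b + a 0 + 1) fun j => a j.succ
    rw [Fin.sum_univ_succ, shiftedε_zero, zpow_add₀ hUV, zpow_natCast]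
    simp only [shiftedε_succ, zpow_add₀ hUV, zpow_natCast, mul_left_comm _ ((U * V : K) ^ (_ : ℕ)),
      ← Finset.mul_sum]
    rw [crossingTypes_ofFn_p_succ] at he ⊢
    rw [crossingTypes_ofFn_succ, shear_blockTypes_append, ← p, evenScale_append, evenScale_p,
      ← evenScale_append, shear_append U V (blockTypes b (p (a 0))),
      shear_append U V (blockTypes b (p (a 0))), evenScale_p, pairShear]
    rw [weight_append] at he ⊢
    rw [shiftedδ_succ] at he ⊢
    push_cast at hd he hi ⊢
    rw [pow_add] at he ⊢
    -- `hi` and `hd` account for the pairs in later blocks, `he` for those in the first block.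
    linear_combination (weight U V (blockTypes b (p (a 0))) : K) *
      diffScale U (blockTypes b (p (a 0))) * hi +
      hd * (-((U * V - 1) * (-1) ^ (shiftedδ (b + a 0 + 1) fun j => a j.succ) *
        ∑ i : Fin n, ((a i.succ / 2 : ℕ) : K) *
          (U * V : K) ^ shiftedε (b + a 0 + 1) (fun j => a j.succ) i)) +
      he * (-((a 0 / 2 : ℕ) * ((U * V - 1) * (U * V : K) ^ ((p b : ℤ) - 1))))

end Recursion

/-! ### The sign of the clasp and the conclusion -/

theorem s_self {n : ℕ} (a : Fin n → ℕ) : s a n = ∑ i, (a i + 1) := by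
  simp [s]

theorem oddLeavesBottom_twistWord {n : ℕ} (hn : 0 < n) (a : Fin n → ℕ) :
    oddLeavesBottom (twistWord (List.ofFn a)) = decide (Even (s a n)) := by
  obtain ⟨n, rfl⟩ := Nat.exists_eq_succ_of_ne_zero hn.ne'
  -- `s` counts a virtual crossing after every block, the twist none after the last; hence the `+
  -- 1`.
  have h : (twistWord (List.ofFn a)).length + 1 = s a (n + 1) := by
    rw [s_self, List.ofFn_succ, length_twistWord, ← List.ofFn_succ, List.map_ofFn, List.sum_ofFn]
    rfl
  simp only [oddLeavesBottom, ← h, Nat.even_add_one, Nat.not_even_iff_odd]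

theorem even_s_p {n : ℕ} (a : Fin n → ℕ) : Even (s (fun i => p (a i)) n) ↔ Even (s a n) := by
  rw [s_self, s_self, Nat.even_iff, Nat.even_iff, Finset.sum_nat_mod,
    Finset.sum_nat_mod _ _ fun i => a i + 1]
  simp [p]

/-- The determinant is affine in the shear, with slopes of opposite signs for the two clasps; this
is the source of `(-1) ^ s(n)`. -/
theorem claspDet_add {R : Type*} [CommRing R] (k : ℕ) (u v x y τ τ' : R) :
    claspDet (decide (Even k)) u v x y τ' = claspDet (decide (Even k)) u v x y τ -
      (-1) ^ k * ((u - 1) * (v - 1) * (τ' - τ)) := by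
  by_cases hk : Even k
  · simp only [claspDet, hk, decide_true, cond_true, hk.neg_one_pow]; ring
  · simp only [claspDet, hk, decide_false, cond_false, (Nat.not_even_iff_odd.1 hk).neg_one_pow]
    ring

theorem algebraMap_trivialFactor_ne_zero : algebraMap PolyUV RatUV trivialFactor ≠ 0 := by
  rw [Ne, FaithfulSMul.algebraMap_eq_zero_iff]
  intro h
  simpa [trivialFactor, u, v] using congrArg (MvPolynomial.eval fun _ => (2 : ℤ)) h

end VirtualTwist
end

open VirtualTwist in
theorem VirtualTwist.algebraMap_alexanderPoly_VT {n : ℕ} (hn : 0 < n) (a : Fin n → ℕ) :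
    algebraMap PolyUV RatUV (alexanderPoly (VT a)) =
      (-(algebraMap PolyUV RatUV (u * v))) ^ (∑ i, a i / 2) *
        (algebraMap PolyUV RatUV (alexanderPoly (VT fun i => p (a i))) +
          algebraMap PolyUV RatUV trivialFactor * ((-1) ^ (δ a + s a n) *
            ∑ i, ((a i / 2 : ℕ) : RatUV) * (algebraMap PolyUV RatUV (u * v)) ^ ε a i)) := by
  let U := Units.mk0 _ algebraMap_u_ne_zero
  let V := Units.mk0 _ algebraMap_v_ne_zero
  have hU : algebraMap PolyUV RatUV u = U := rfl
  have hV : algebraMap PolyUV RatUV v = V := rfl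
  have hδ : shiftedδ 0 a = δ a := by simp [shiftedδ, δ]
  have hε (i) : shiftedε 0 a i = ε a i := by simp [shiftedε, ε]
  have h0 := oddOnTop_twistWord (b := 0)
  rw [decide_eq_true Even.zero] at h0
  have hs := weight_mul_shear_p U V 0 a
  simp only [hδ, hε] at hs
  have hc := claspDet_add (s a n) (U : RatUV) V
    (evenScale V (crossingTypes 0 (List.ofFn fun i => p (a i))))
    (diffScale U (crossingTypes 0 (List.ofFn fun i => p (a i))))
    (shear U V (crossingTypes 0 (List.ofFn fun i => p (a i))))
    (shear U V (crossingTypes 0 (List.ofFn a)))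
  rw [VT, VT, map_alexanderPoly _ hU hV, map_alexanderPoly _ hU hV, h0, h0,
    oddLeavesBottom_twistWord hn, oddLeavesBottom_twistWord hn, weight_p, evenScale_p, diffScale_p,
    hc, trivialFactor]
  simp only [even_s_p, map_mul, map_sub, map_one, hU, hV]
  push_cast
  linear_combination (-(-1) ^ s a n * ((U : RatUV) - 1) * (V - 1) *
    (-(U * V : RatUV)) ^ (∑ i, a i / 2)) * hs

theorem theoremT (n : ℕ) (hn : 0 < n) (a : Fin n → ℕ) :
    VirtualTwist.trivialFactor ∣ VirtualTwist.alexanderPoly (VirtualTwist.VT a) ∧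
    VirtualTwist.reducedAlexander (VirtualTwist.VT a) =
      (-(algebraMap VirtualTwist.PolyUV VirtualTwist.RatUV (VirtualTwist.u * VirtualTwist.v))) ^
          (∑ i, a i / 2) *
        (VirtualTwist.reducedAlexander (VirtualTwist.VT fun i => VirtualTwist.p (a i)) +
          (-1) ^ (VirtualTwist.δ a + VirtualTwist.s a n) *
            ∑ i, ((a i / 2 : ℕ) : VirtualTwist.RatUV) *
              (algebraMap VirtualTwist.PolyUV VirtualTwist.RatUV
                (VirtualTwist.u * VirtualTwist.v)) ^ VirtualTwist.ε a i) := by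
  refine ⟨VirtualTwist.trivialFactor_dvd _, ?_⟩
  have hF := VirtualTwist.algebraMap_trivialFactor_ne_zero
  rw [VirtualTwist.reducedAlexander, VirtualTwist.reducedAlexander,
    VirtualTwist.algebraMap_alexanderPoly_VT hn, mul_div_assoc, add_div, mul_div_cancel_left₀ _ hF]
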